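/- Let $\varphi$ be an orientation preserving homeomorphism of the circle $\mathbb R/\mathbb Z$ with a lift $\Phi:\mathbb R\to\mathbb R$, let $\varrho=\lim_{n\to\infty}(\Phi^n(x)-x)/n$ be its rotation number, assume that $\varrho$ is irrational, and let $\mu$ be the (unique) $\varphi$-invariant Borel probability measure. For $x_0\in\mathbb R$ put $$z_n(x_0)=\sum_{k=0}^{n-1}\exp(2\pi i\,\Phi^k(x_0)),\qquad n=0,1,2,\dots,$$ let $\Gamma(x_0)$ be the infinite piecewise linear curve in $\mathbb C$ through $z_0(x_0),z_1(x_0),z_2(x_0),\dots$ consecutively, and let $\Gamma_t(x_0)$ be its initial part of length $t$. Put $v=\int\exp(2\pi i x)\,d\mu(x)$. An unbounded curve $\Gamma$ is called superficial if $t/\operatorname{Diam}\Gamma_t\to\infty$ as $t\to\infty$; a bounded curve $\Gamma$ is called superficial if $\operatorname{Area}(\Gamma^{\varepsilon})/\varepsilon\to\infty$ as $\varepsilon\to0^+$, where $\Gamma^\varepsilon$ is the open $\varepsilon$-neighbourhood of $\Gamma$. Let $a_0,a_1,\dots$ be the partial quotients of $\varrho$, that is, $\varrho=\lfloor\varrho\rfloor+[0;a_0,a_1,a_2,\dots]$,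 and let $q_n$ be the denominators of its continued fraction convergents. Consider the conditions: 1. $\varrho$ is Diophantine of type $r$, for some $r>1$: there is $C>0$ with $|\varrho-p/q|\ge C/q^{1+r}$ for all integers $p$ and $q\geq 1$; 2. $\varrho$ is of bounded type: the ratios $q_{n+1}/q_n$ are bounded; 3. for some $\varepsilon>0$, $a_m<(m+1)^{1+\varepsilon}$ for all sufficiently large $m$. (A) Suppose $v=0$. Then there is a constant $M$ such that for all $x_0\in\mathbb R$ and all integers $n\ge2$: * $|z_n(x_0)|\le M\,n^{1-1/r}\log n$ if condition 1 holds with the given $r$; * $|z_n(x_0)|\le M\log n$ if condition 2 holds; * $|z_n(x_0)|\le M\,(\log n)^{2+\varepsilon}$ if condition 3 holds with the given $\varepsilon$. (The constant $M$ may be different in the three cases and may depend on $\varphi$ and on $r$ or $\varepsilon$, but not on $x_0$ and $n$.) In each of these cases $\Gamma(x_0)$ is superficial for every $x_0\in\mathbb R$. (B) Suppose $v\ne0$. Then $\Gamma(x_0)$ is not superficial, for every $x_0\in\mathbb R$. If moreover $\varrho$ satisfies at least one of the conditions 1, 2, 3, then there are a constant $M$ and a function $l:\mathbb N\to\mathbb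 R$ with $\lim_{n\to\infty}l(n)/n=0$ such that $$|z_n(x_0)-nv|\le M\,l(n)\qquad\text{for all }x_0\in\mathbb R\text{ and all }n\in\mathbb N.$$ -/

import Mathlib

open MeasureTheory Filter Topology

/-- `Φ` is a lift to the real line of the homeomorphism `φ` of the circle `ℝ/ℤ`. Since
`CircleDeg1Lift` is the type of increasing maps `Φ : ℝ → ℝ` with `Φ (x + 1) = Φ x + 1`, the
homeomorphisms having such a lift are the orientation preserving ones. The rotation number
of `φ` is the class modulo `1` of
`Φ.translationNumber = lim (Φ^n x - x) / n`. -/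
def IsLiftOfHomeo (Φ : CircleDeg1Lift) (φ : UnitAddCircle ≃ₜ UnitAddCircle) : Prop :=
  Continuous Φ ∧ ∀ x : ℝ, ((Φ x : ℝ) : UnitAddCircle) = φ (x : UnitAddCircle)

/-- The orbit `u_n = Φ^n x₀` of the point `x₀`. -/
def orbitSeq (Φ : CircleDeg1Lift) (x₀ : ℝ) : ℕ → ℝ := fun n => (⇑Φ)^[n] x₀

/-- The vertices `z_n = ∑_{k<n} exp (2 π i u_k)` of the curlicue of the sequence `u`. -/
noncomputable def curlicueVertex (u : ℕ → ℝ) (n : ℕ) : ℂ :=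
  ∑ k ∈ Finset.range n, Complex.exp (2 * Real.pi * Complex.I * (u k : ℂ))

/-- The curlicue of the sequence `u`: the piecewise linear curve through `z_0, z_1, z_2, …`,
parametrized on `[0, ∞)` by arc length (each edge has length `1`). -/
noncomputable def curlicue (u : ℕ → ℝ) (t : ℝ) : ℂ :=
  curlicueVertex u ⌊t⌋₊ +
    ((t - (⌊t⌋₊ : ℝ) : ℝ) : ℂ) * Complex.exp (2 * Real.pi * Complex.I * (u ⌊t⌋₊ : ℂ))

/-- Superficiality of a curve given by its parametrization `γ` on `[0, ∞)` by arc length, so that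
`γ '' Set.Icc 0 t` is the initial part `Γ_t` of length `t`. For an unbounded curve it means
`t / Diam Γ_t → ∞` as `t → ∞`; for a bounded curve it means `Area Γ^ε / ε → ∞` as `ε → 0⁺`,
where `Γ^ε` is the open `ε`-neighbourhood of `Γ`. -/
def IsSuperficial (γ : ℝ → ℂ) : Prop :=
  (¬ Bornology.IsBounded (γ '' Set.Ici 0) ∧
    Tendsto (fun t : ℝ => t / Metric.diam (γ '' Set.Icc 0 t)) atTop atTop) ∨
  (Bornology.IsBounded (γ '' Set.Ici 0) ∧
    Tendsto (fun ε : ℝ => (volume (Metric.thickening ε (γ '' Set.Ici 0))).toReal / ε)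
      (𝓝[>] 0) atTop)

/-- `ρ` is Diophantine of type `r > 1`. -/
def IsDiophantineOfType (ρ r : ℝ) : Prop :=
  1 < r ∧ ∃ C : ℝ, 0 < C ∧ ∀ (p : ℤ) (q : ℕ), 0 < q →
    C / (q : ℝ) ^ (1 + r) ≤ |ρ - (p : ℝ) / (q : ℝ)|

/-- `ρ` is of bounded type: the ratios `q_{n+1} / q_n` of successive denominators of the continued
fraction convergents of `ρ` are bounded. -/
def IsOfBoundedType (ρ : ℝ) : Prop :=
  ∃ B : ℝ, ∀ n : ℕ, (GenContFract.of ρ).dens (n + 1) / (GenContFract.of ρ).dens n ≤ B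

/-- Writing `ρ = ⌊ρ⌋ + [0; a_0, a_1, a_2, …]`, one has `a_m < (m + 1) ^ (1 + ε)` for all large `m`.
(The sequence `partDens` starts with `a_0`, and does not terminate if `ρ` is irrational.) -/
def HasSlowPartialQuotients (ρ ε : ℝ) : Prop :=
  ∀ᶠ m : ℕ in atTop, ∀ a : ℝ, (GenContFract.of ρ).partDens.get? m = some a →
    a < ((m : ℝ) + 1) ^ (1 + ε)

/-- `ρ` satisfies one of the three arithmetic conditions. -/
def SatisfiesArithmeticCondition (ρ : ℝ) : Prop :=
  (∃ r : ℝ, IsDiophantineOfType ρ r) ∨ IsOfBoundedType ρ ∨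
    ∃ ε : ℝ, 0 < ε ∧ HasSlowPartialQuotients ρ ε

/-- The average `∫ exp (2 π i x) dμ(x)` over the circle `ℝ/ℤ`; here `AddCircle.toCircle` is the map
`x ↦ exp (2 π i x)`. -/
noncomputable def circleAverage (μ : Measure UnitAddCircle) : ℂ :=
  ∫ y, (AddCircle.toCircle y : ℂ) ∂μ

/-!
Write `ρ` for the rotation number, `v` for the mean of `exp (2 π i x)` with respect to `μ`, and
`D_n(x) = z_n(x) - n v`. Everything follows from a bound for `D_n` that is uniform in `x`.

The integer translates of the points of an orbit are ordered like the numbers `k ρ + m`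
(`iterate_add_lt_of_lt`). If `|ρ - p / q| ≤ 1 / q²` with `p, q` coprime, this means that, up to
errors of one or two places, the first `q` points of any orbit lie on the circle in the order of the
multiples of `p` modulo `q`. Hence the first `q` points of two orbits interleave
(`levelPoint_interleave`), and the Birkhoff sums of length `q` of a Lipschitz function differ by a
telescoping sum, which is bounded independently of `q` (`norm_birkhoff_sub_birkhoff_le`). Averaging
over the second orbit with respect to `μ` yields the Denjoy–Koksma inequality: `D_q` is bounded
whenever `q` is the denominator of a convergent (`norm_curlicueVertex_convDen_sub_le`). Neither a
conjugacy to a rotation nor unique ergodicity is needed.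

Since `D` is an additive cocycle, the expansion of `n` in the denominators `q_i` gives
`|D_n| = O(n / q_m + ∑_{i < m} q_{i+1} / q_i)` for every `m` (`norm_cocycle_le`). For fixed large `m`
this shows `D_n = o(n)`, for every irrational `ρ`. For `q_m ≤ n < q_{m+1}` one has `m = O(log n)`,
and each arithmetic condition bounds the ratios, which gives the three estimates.

If `v ≠ 0`, then `|z_n|` grows linearly, so `Γ_t` has diameter at least a constant times `t`, and
`Γ` is not superficial. If `v = 0`, then `z_n = o(n)`, so `t / Diam Γ_t → ∞`; this settles the case
of an unbounded `Γ`. A bounded `Γ` is superficial because the directions of its edges are pairwise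
distinct, so that each edge is parallel to at most one other: one can choose arbitrarily many unit
edges no two of which are parallel, and the overlaps of their `ε`-neighbourhoods have area `O(ε²)`
(`eventually_card_mul_le_volume_thickening`).
-/

/-! ### Convergents of an irrational number -/

/-- The denominator `q_n` of the `n`-th continued fraction convergent of `ρ`, as a natural number.
Convergents are numbered as in `GenContFract.dens`, so `q_0 = 1`. -/
noncomputable def convDen (ρ : ℝ) (n : ℕ) : ℕ := ⌊(GenContFract.of ρ).dens n⌋₊

theorem not_terminatedAt_of_irrational {ρ : ℝ} (hρ : Irrational ρ) (n : ℕ) :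
    ¬ (GenContFract.of ρ).TerminatedAt n := by
  intro h
  obtain ⟨q, hq⟩ := GenContFract.exists_rat_eq_of_terminates (v := ρ) ⟨n, h⟩
  exact hρ ⟨q, hq.symm⟩

theorem exists_int_contsAux (ρ : ℝ) (n : ℕ) :
    (∃ a b : ℤ, (GenContFract.of ρ).contsAux n = ⟨a, b⟩) ∧
      ∃ a b : ℤ, (GenContFract.of ρ).contsAux (n + 1) = ⟨a, b⟩ := by
  induction n with
  | zero =>
    refine ⟨⟨1, 0, by simp⟩, ⟨⌊ρ⌋, 1, by simp⟩⟩
  | succ n ih =>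
    refine ⟨ih.2, ?_⟩
    obtain ⟨⟨a, b, h1⟩, ⟨c, d, h2⟩⟩ := ih
    by_cases ht : (GenContFract.of ρ).TerminatedAt n
    · exact ⟨c, d, (GenContFract.contsAux_stable_step_of_terminated ht).trans h2⟩
    · obtain ⟨gp, hgp⟩ := Option.ne_none_iff_exists'.1 ht
      obtain ⟨hnum, z, hz⟩ := GenContFract.of_partNum_eq_one_and_exists_int_partDen_eq hgp
      refine ⟨z * c + a, z * d + b, ?_⟩
      rw [GenContFract.contsAux_recurrence hgp h1 h2, hnum, hz]
      push_cast
      simp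

theorem convDen_cast (ρ : ℝ) (n : ℕ) : (convDen ρ n : ℝ) = (GenContFract.of ρ).dens n := by
  obtain ⟨a, b, h⟩ := (exists_int_contsAux ρ n).2
  have hb : (GenContFract.of ρ).dens n = (b : ℝ) := by
    rw [GenContFract.den_eq_conts_b, GenContFract.nth_cont_eq_succ_nth_contAux, h]
  have h0 : 0 ≤ b := by
    have : (0 : ℝ) ≤ (GenContFract.of ρ).dens n := GenContFract.zero_le_of_den
    rw [hb] at this
    exact_mod_cast this
  lift b to ℕ using h0
  rw [convDen, hb]
  simp

@[simp]
theorem convDen_zero (ρ : ℝ) : convDen ρ 0 = 1 := by simp [convDen]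

theorem convDen_le_succ (ρ : ℝ) (n : ℕ) : convDen ρ n ≤ convDen ρ (n + 1) :=
  Nat.floor_mono GenContFract.of_den_mono

theorem convDen_mono (ρ : ℝ) : Monotone (convDen ρ) := monotone_nat_of_le_succ (convDen_le_succ ρ)

theorem convDen_pos (ρ : ℝ) (n : ℕ) : 0 < convDen ρ n :=
  (by simp : 0 < convDen ρ 0).trans_le (convDen_mono ρ n.zero_le)

/-- The recurrence `q_{n+2} = a_{n+1} q_{n+1} + q_n`, with `a_{n+1} ≥ 1`. -/
theorem convDen_recurrence {ρ : ℝ} (hρ : Irrational ρ) (n : ℕ) :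
    ∃ a : ℝ, (GenContFract.of ρ).partDens.get? (n + 1) = some a ∧ 1 ≤ a ∧
      (convDen ρ (n + 2) : ℝ) = a * convDen ρ (n + 1) + convDen ρ n := by
  obtain ⟨gp, hgp⟩ := Option.ne_none_iff_exists'.1 (not_terminatedAt_of_irrational hρ (n + 1))
  have hb := GenContFract.partDen_eq_s_b hgp
  refine ⟨gp.b, hb, GenContFract.of_one_le_get?_partDen hb, ?_⟩
  rw [convDen_cast, convDen_cast, convDen_cast, GenContFract.dens_recurrence hgp rfl rfl,
    GenContFract.of_partNum_eq_one (GenContFract.partNum_eq_s_a hgp), one_mul]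

theorem two_mul_convDen_le {ρ : ℝ} (hρ : Irrational ρ) (n : ℕ) :
    2 * convDen ρ n ≤ convDen ρ (n + 2) := by
  obtain ⟨a, -, ha, h⟩ := convDen_recurrence hρ n
  have h1 : (convDen ρ n : ℝ) ≤ convDen ρ (n + 1) := by exact_mod_cast convDen_le_succ ρ n
  have h2 : (2 * convDen ρ n : ℝ) ≤ convDen ρ (n + 2) := by
    rw [h]
    nlinarith [(convDen ρ n).cast_nonneg (α := ℝ)]
  exact_mod_cast h2

theorem convDen_succ_le {ρ : ℝ} (hρ : Irrational ρ) (n : ℕ) :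
    ∃ a : ℝ, (GenContFract.of ρ).partDens.get? n = some a ∧ 1 ≤ a ∧
      (convDen ρ (n + 1) : ℝ) ≤ (a + 1) * convDen ρ n := by
  cases n with
  | zero =>
    obtain ⟨gp, hgp⟩ := Option.ne_none_iff_exists'.1 (not_terminatedAt_of_irrational hρ 0)
    have hb := GenContFract.partDen_eq_s_b hgp
    refine ⟨gp.b, hb, GenContFract.of_one_le_get?_partDen hb, ?_⟩
    rw [convDen_cast, convDen_cast, zero_add, GenContFract.first_den_eq hgp]
    simp
  | succ n =>
    obtain ⟨a, h1, ha, h⟩ := convDen_recurrence hρ n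
    refine ⟨a, h1, ha, ?_⟩
    have : (convDen ρ n : ℝ) ≤ convDen ρ (n + 1) := by exact_mod_cast convDen_le_succ ρ n
    rw [h]
    linarith

theorem two_pow_le_convDen_sq {ρ : ℝ} (hρ : Irrational ρ) (n : ℕ) :
    2 ^ n ≤ 2 * convDen ρ n ^ 2 := by
  induction n using Nat.twoStepInduction with
  | zero => simp
  | one => simpa using Nat.one_le_pow 2 _ (convDen_pos ρ 1)
  | more n ih _ =>
    calc 2 ^ (n + 2) = 4 * 2 ^ n := by ring
      _ ≤ 4 * (2 * convDen ρ n ^ 2) := by gcongr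
      _ = 2 * (2 * convDen ρ n) ^ 2 := by ring
      _ ≤ 2 * convDen ρ (n + 2) ^ 2 := by gcongr; exact two_mul_convDen_le hρ n

theorem tendsto_convDen {ρ : ℝ} (hρ : Irrational ρ) : Tendsto (convDen ρ) atTop atTop := by
  refine tendsto_atTop_atTop_of_monotone (convDen_mono ρ) fun b => ⟨2 * b + 1, ?_⟩
  have h1 := two_pow_le_convDen_sq hρ (2 * b + 1)
  have h2 : b < 2 ^ b := Nat.lt_two_pow_self
  have h3 : 2 ^ (2 * b + 1) = 2 * (2 ^ b) ^ 2 := by rw [pow_succ, mul_comm 2 b, pow_mul]; ring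
  rw [h3] at h1
  exact h2.le.trans ((Nat.pow_le_pow_iff_left two_ne_zero).1 (by omega))

/-- Each `n ≥ 1` lies between two consecutive denominators `q_m ≤ n < q_{m+1}`. -/
theorem exists_convDen_le_lt {ρ : ℝ} (hρ : Irrational ρ) {n : ℕ} (hn : 1 ≤ n) :
    ∃ m, convDen ρ m ≤ n ∧ n < convDen ρ (m + 1) := by
  have hex : ∃ m, n < convDen ρ m := ((tendsto_convDen hρ).eventually_gt_atTop n).exists
  classical
  have h0 : Nat.find hex ≠ 0 := by
    intro h
    have := Nat.find_spec hex
    rw [h, convDen_zero] at this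
    omega
  obtain ⟨m, hm⟩ := Nat.exists_eq_succ_of_ne_zero h0
  refine ⟨m, not_lt.1 (Nat.find_min hex (by omega)), ?_⟩
  have := Nat.find_spec hex
  rwa [hm] at this

/-- The convergents are reduced fractions with `|ρ - p_n / q_n| ≤ 1 / (q_n q_{n+1})`. -/
theorem exists_convergent {ρ : ℝ} (hρ : Irrational ρ) (n : ℕ) :
    ∃ p : ℤ, IsCoprime p (convDen ρ n : ℤ) ∧
      |ρ - p / convDen ρ n| ≤ 1 / (convDen ρ n * convDen ρ (n + 1)) := by
  obtain ⟨⟨p, b, h1⟩, ⟨p', d, h2⟩⟩ := exists_int_contsAux ρ (n + 1)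
  have hp : (GenContFract.of ρ).nums n = p := by
    rw [GenContFract.num_eq_conts_a, GenContFract.nth_cont_eq_succ_nth_contAux, h1]
  have hp' : (GenContFract.of ρ).nums (n + 1) = p' := by
    rw [GenContFract.num_eq_conts_a, GenContFract.nth_cont_eq_succ_nth_contAux, h2]
  refine ⟨p, ?_, ?_⟩
  · have hdet := SimpContFract.determinant (s := SimpContFract.of ρ)
      (not_terminatedAt_of_irrational hρ n)
    change (GenContFract.of ρ).nums n * (GenContFract.of ρ).dens (n + 1) -
      (GenContFract.of ρ).dens n * (GenContFract.of ρ).nums (n + 1) = _ at hdet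
    rw [hp, hp', ← convDen_cast, ← convDen_cast] at hdet
    have hdet' : p * (convDen ρ (n + 1) : ℤ) - convDen ρ n * p' = (-1) ^ (n + 1) := by
      exact_mod_cast hdet
    have hsq : ((-1 : ℤ) ^ (n + 1)) * (-1) ^ (n + 1) = 1 := by rw [← mul_pow]; simp
    refine ⟨(-1) ^ (n + 1) * convDen ρ (n + 1), -((-1) ^ (n + 1) * p'), ?_⟩
    linear_combination (-1) ^ (n + 1) * hdet' + hsq
  · have := GenContFract.abs_sub_convs_le (not_terminatedAt_of_irrational hρ n)
    rwa [GenContFract.conv_eq_num_div_den, hp, ← convDen_cast, ← convDen_cast] at this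

/-! ### The order of an orbit, and the Denjoy–Koksma inequality -/

/-- The integer translates of the points of an orbit are ordered like those of the orbit of the
rotation by the translation number. -/
theorem iterate_add_lt_of_lt (Φ : CircleDeg1Lift) (x : ℝ) {k k' : ℕ} {m m' : ℤ}
    (h : k * Φ.translationNumber + m < k' * Φ.translationNumber + m') :
    (⇑Φ)^[k] x + m < (⇑Φ)^[k'] x + m' := by
  rcases le_total k k' with hk | hk
  · obtain ⟨d, rfl⟩ := Nat.exists_eq_add_of_le hk
    by_contra! hle
    have h1 : (Φ ^ d) ((⇑Φ)^[k] x) ≤ (⇑Φ)^[k] x + ((m - m' : ℤ) : ℝ) := by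
      rw [CircleDeg1Lift.coe_pow, ← Function.iterate_add_apply, add_comm d k]
      push_cast
      linarith
    have h2 := CircleDeg1Lift.translationNumber_le_of_le_add_int _ h1
    rw [CircleDeg1Lift.translationNumber_pow] at h2
    push_cast at h h2
    linarith
  · obtain ⟨d, rfl⟩ := Nat.exists_eq_add_of_le hk
    by_contra! hle
    have h1 : (⇑Φ)^[k'] x + ((m' - m : ℤ) : ℝ) ≤ (Φ ^ d) ((⇑Φ)^[k'] x) := by
      rw [CircleDeg1Lift.coe_pow, ← Function.iterate_add_apply, add_comm d k']
      push_cast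
      linarith
    have h2 := CircleDeg1Lift.le_translationNumber_of_add_int_le _ h1
    rw [CircleDeg1Lift.translationNumber_pow] at h2
    push_cast at h h2
    linarith

/-- If `p / q` approximates the translation number within `1 / q²`, the point `Φ^k x + m` with
`k < 2 q` has level `k p + m q`: points whose levels differ by at least `2` are ordered like their
levels. -/
theorem iterate_add_lt_of_level_add_two_le {Φ : CircleDeg1Lift} {p : ℤ} {q : ℕ} (hq : 0 < q)
    (h : |Φ.translationNumber - p / q| ≤ 1 / (q : ℝ) ^ 2) (x : ℝ) {k k' : ℕ} {m m' : ℤ}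
    (hk : k < 2 * q) (hk' : k' < 2 * q) (hl : k * p + m * q + 2 ≤ k' * p + m' * q) :
    (⇑Φ)^[k] x + m < (⇑Φ)^[k'] x + m' := by
  apply iterate_add_lt_of_lt
  set τ := Φ.translationNumber
  have hq' : (0 : ℝ) < q := by exact_mod_cast hq
  have hl' : (k * p + m * q + 2 : ℝ) ≤ k' * p + m' * q := by exact_mod_cast hl
  have hk1 : (k : ℝ) < 2 * q := by exact_mod_cast hk
  have hk2 : (k' : ℝ) < 2 * q := by exact_mod_cast hk'
  have hd : |(k' : ℝ) - k| < 2 * q := by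
    have := k.cast_nonneg (α := ℝ)
    have := k'.cast_nonneg (α := ℝ)
    rw [abs_lt]
    constructor <;> linarith
  have h1 : |((k' : ℝ) - k) * (τ - p / q)| < 2 / q := by
    rw [abs_mul]
    calc |(k' : ℝ) - k| * |τ - p / q| ≤ |(k' : ℝ) - k| * (1 / (q : ℝ) ^ 2) := by gcongr
      _ < 2 * q * (1 / (q : ℝ) ^ 2) := by gcongr
      _ = 2 / q := by field_simp
  have h2 := (abs_lt.1 h1).1
  have h3 : 2 / (q : ℝ) ≤ ((k' * p + m' * q) - (k * p + m * q)) / q := by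
    gcongr
    linarith
  have h4 : k' * τ + m' - (k * τ + m) =
      ((k' : ℝ) - k) * (τ - p / q) + ((k' * p + m' * q) - (k * p + m * q)) / q := by
    field_simp
    ring
  linarith

/-- Given `a p + b q = 1`, the time `0 ≤ k < q` of the point of level `j` in an orbit, that is,
the residue of `a j` modulo `q`. -/
def levelTime (q : ℕ) (a j : ℤ) : ℕ := ((a * j) % q).toNat

/-- Given `a p + b q = 1`, the integer `m` with `k p + m q = j`, where `k` is `levelTime q a j`. -/
def levelShift (p : ℤ) (q : ℕ) (a b j : ℤ) : ℤ := b * j + p * (a * j / q)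

/-- The point `Φ^k y + m` with `0 ≤ k < q` of level `k p + m q = j`. -/
noncomputable def levelPoint (Φ : CircleDeg1Lift) (p : ℤ) (q : ℕ) (a b : ℤ) (y : ℝ) (j : ℤ) : ℝ :=
  (⇑Φ)^[levelTime q a j] y + levelShift p q a b j

section Level

variable {Φ : CircleDeg1Lift} {p : ℤ} {q : ℕ} {a b : ℤ}

theorem levelTime_cast (hq : 0 < q) (j : ℤ) : (levelTime q a j : ℤ) = (a * j) % q :=
  Int.toNat_of_nonneg (Int.emod_nonneg _ (by omega))

theorem levelTime_lt (hq : 0 < q) (j : ℤ) : levelTime q a j < q := by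
  have h := levelTime_cast (a := a) hq j
  have := Int.emod_lt_of_pos (a * j) (b := (q : ℤ)) (by omega)
  omega

theorem level_eq (hq : 0 < q) (hab : a * p + b * q = 1) (j : ℤ) :
    levelTime q a j * p + levelShift p q a b j * q = j := by
  rw [levelTime_cast hq, levelShift, Int.emod_def]
  linear_combination j * hab

theorem levelPoint_add_period (hq : 0 < q) (hab : a * p + b * q = 1) (y : ℝ) (j : ℤ) :
    levelPoint Φ p q a b y (j + q) = levelPoint Φ p q a b y j + 1 := by
  have hq' : (q : ℤ) ≠ 0 := by omega
  have h1 : levelTime q a (j + q) = levelTime q a j := by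
    rw [levelTime, levelTime, mul_add, Int.add_mul_emod_self_right]
  have h2 : levelShift p q a b (j + q) = levelShift p q a b j + 1 := by
    rw [levelShift, levelShift, mul_add a, Int.add_mul_ediv_right _ _ hq']
    linear_combination hab
  rw [levelPoint, levelPoint, h1, h2]
  push_cast
  ring

theorem levelPoint_mul_period (hq : 0 < q) (hab : a * p + b * q = 1) (y : ℝ) (t : ℤ) :
    levelPoint Φ p q a b y (t * q) = y + t := by
  have hq' : (q : ℤ) ≠ 0 := by omega
  have h1 : levelTime q a (t * q) = 0 := by
    rw [levelTime, ← mul_assoc, Int.mul_emod_left]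
    rfl
  have h2 : levelShift p q a b (t * q) = t := by
    rw [levelShift, ← mul_assoc a, Int.mul_ediv_cancel _ hq']
    linear_combination t * hab
  rw [levelPoint, h1, h2, Function.iterate_zero_apply]

theorem sum_levelTime {E : Type*} [AddCommMonoid E] (hq : 0 < q) (hab : a * p + b * q = 1)
    (g : ℕ → E) (s : ℤ) :
    ∑ j ∈ Finset.range q, g (levelTime q a (s + j)) = ∑ k ∈ Finset.range q, g k := by
  have hmaps : Set.MapsTo (fun j : ℕ => levelTime q a (s + j)) (Finset.range q)
      (Finset.range q) := fun j _ => by simpa using levelTime_lt hq _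
  have hinj : Set.InjOn (fun j : ℕ => levelTime q a (s + j)) (Finset.range q) := by
    intro i hi j hj hij
    have h1 : (a * (s + i)) % (q : ℤ) = (a * (s + j)) % q := by
      rw [← levelTime_cast hq, ← levelTime_cast hq]
      exact_mod_cast hij
    obtain ⟨c, hc⟩ := Int.ModEq.dvd h1
    have h2 : (q : ℤ) ∣ (j : ℤ) - i :=
      ⟨p * c + b * (j - i), by linear_combination p * hc - ((j : ℤ) - i) * hab⟩
    simp only [Finset.coe_range, Set.mem_Iio] at hi hj
    have := Int.eq_zero_of_abs_lt_dvd h2 (by rw [abs_lt]; constructor <;> omega)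
    omega
  exact Finset.sum_nbij _ hmaps hinj
    (Finset.surjOn_of_injOn_of_card_le _ hmaps hinj le_rfl) fun _ _ => rfl

theorem sum_levelPoint (hq : 0 < q) (hab : a * p + b * q = 1) {f : ℝ → ℂ}
    (hf : Function.Periodic f 1) (y : ℝ) (s : ℤ) :
    ∑ j ∈ Finset.range q, f (levelPoint Φ p q a b y (s + j)) =
      ∑ k ∈ Finset.range q, f ((⇑Φ)^[k] y) := by
  rw [← sum_levelTime hq hab (fun k => f ((⇑Φ)^[k] y)) s]
  refine Finset.sum_congr rfl fun j _ => ?_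
  rw [levelPoint]
  simpa using hf.int_mul (levelShift p q a b (s + j)) ((⇑Φ)^[levelTime q a (s + j)] y)

theorem sum_levelPoint_add_one (hq : 0 < q) (hab : a * p + b * q = 1) (y : ℝ) (s : ℤ) :
    ∑ j ∈ Finset.range q, levelPoint Φ p q a b y (s + 1 + j) =
      ∑ j ∈ Finset.range q, levelPoint Φ p q a b y (s + j) + 1 := by
  have h := Finset.sum_range_sub (fun j : ℕ => levelPoint Φ p q a b y (s + j)) q
  simp only [levelPoint_add_period hq hab, Finset.sum_sub_distrib] at h
  have h' : ∀ j : ℕ, s + ((j + 1 : ℕ) : ℤ) = s + 1 + j := fun j => by push_cast; ring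
  simp only [h', Nat.cast_zero, add_zero] at h
  linarith

theorem exists_levelPoint_le_lt (hq : 0 < q) (hab : a * p + b * q = 1) (x y : ℝ) :
    ∃ s, levelPoint Φ p q a b y s ≤ x ∧ x < levelPoint Φ p q a b y (s + 1) := by
  set t : ℤ := ⌊x - y⌋
  have h0 : levelPoint Φ p q a b y (t * q) ≤ x := by
    rw [levelPoint_mul_period hq hab]
    linarith [Int.floor_le (x - y)]
  have hex : ∃ n : ℕ, x < levelPoint Φ p q a b y (t * q + n) := by
    refine ⟨q, ?_⟩
    rw [levelPoint_add_period hq hab, levelPoint_mul_period hq hab]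
    linarith [Int.lt_floor_add_one (x - y)]
  classical
  obtain ⟨n, hn⟩ : ∃ n, Nat.find hex = n + 1 := by
    refine Nat.exists_eq_succ_of_ne_zero fun h => ?_
    have := Nat.find_spec hex
    rw [h] at this
    simp only [Nat.cast_zero, add_zero] at this
    linarith
  refine ⟨t * q + n, not_lt.1 (Nat.find_min hex (by omega)), ?_⟩
  have := Nat.find_spec hex
  rw [hn] at this
  rwa [add_assoc, ← Nat.cast_succ]

theorem iterate_levelPoint (y : ℝ) (k : ℕ) (s : ℤ) :
    (⇑Φ)^[k] (levelPoint Φ p q a b y s) =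
      (⇑Φ)^[k + levelTime q a s] y + levelShift p q a b s := by
  rw [levelPoint, Function.iterate_add_apply, ← CircleDeg1Lift.coe_pow Φ k,
    CircleDeg1Lift.map_add_int]

/-- The points of two orbits interleave, up to a bounded shift of the levels. -/
theorem levelPoint_interleave (hq : 0 < q) (hab : a * p + b * q = 1)
    (h : |Φ.translationNumber - p / q| ≤ 1 / (q : ℝ) ^ 2) {x y : ℝ} {s : ℤ}
    (h1 : levelPoint Φ p q a b y s ≤ x) (h2 : x ≤ levelPoint Φ p q a b y (s + 1)) (j : ℤ) :
    levelPoint Φ p q a b y (s - 2 + j) ≤ levelPoint Φ p q a b x j ∧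
      levelPoint Φ p q a b x j ≤ levelPoint Φ p q a b y (s + 3 + j) := by
  have hmono := Φ.monotone.iterate (levelTime q a j)
  have h1' := hmono h1
  have h2' := hmono h2
  rw [iterate_levelPoint] at h1' h2'
  have lt := fun i => levelTime_lt (a := a) hq i
  have lev := fun i => level_eq hq hab i
  constructor
  · have := iterate_add_lt_of_level_add_two_le hq h y (k := levelTime q a (s - 2 + j))
      (k' := levelTime q a j + levelTime q a s) (m := levelShift p q a b (s - 2 + j))
      (m' := levelShift p q a b j + levelShift p q a b s) (by linarith [lt (s - 2 + j)])
      (by linarith [lt j, lt s]) (by push_cast; linarith [lev (s - 2 + j), lev j, lev s])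
    push_cast at this
    rw [levelPoint, levelPoint]
    linarith
  · have := iterate_add_lt_of_level_add_two_le hq h y (k' := levelTime q a (s + 3 + j))
      (k := levelTime q a j + levelTime q a (s + 1)) (m' := levelShift p q a b (s + 3 + j))
      (m := levelShift p q a b j + levelShift p q a b (s + 1)) (by linarith [lt j, lt (s + 1)])
      (by linarith [lt (s + 3 + j)])
      (by push_cast; linarith [lev (s + 3 + j), lev j, lev (s + 1)])
    push_cast at this
    rw [levelPoint, levelPoint]
    linarith

theorem levelPoint_lt_of_add_two_le (hq : 0 < q) (hab : a * p + b * q = 1)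
    (h : |Φ.translationNumber - p / q| ≤ 1 / (q : ℝ) ^ 2) (y : ℝ) {i j : ℤ} (hij : i + 2 ≤ j) :
    levelPoint Φ p q a b y i < levelPoint Φ p q a b y j :=
  iterate_add_lt_of_level_add_two_le hq h y (by linarith [levelTime_lt (a := a) hq i])
    (by linarith [levelTime_lt (a := a) hq j])
    (by linarith [level_eq hq hab i, level_eq hq hab j])

end Level

/-- Denjoy–Koksma inequality for two orbits: at the denominator of a good rational approximation of
the translation number, the Birkhoff sums of a periodic Lipschitz function vary boundedly. -/
theorem norm_birkhoff_sub_birkhoff_le {Φ : CircleDeg1Lift} {p : ℤ} {q : ℕ} (hq : 0 < q)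
    (hpq : IsCoprime p (q : ℤ)) (h : |Φ.translationNumber - p / q| ≤ 1 / (q : ℝ) ^ 2)
    {f : ℝ → ℂ} (hf : Function.Periodic f 1) {K : ℝ} (hK : ∀ s t, ‖f s - f t‖ ≤ K * |s - t|)
    (x y : ℝ) :
    ‖∑ k ∈ Finset.range q, f ((⇑Φ)^[k] x) - ∑ k ∈ Finset.range q, f ((⇑Φ)^[k] y)‖ ≤ K * 5 := by
  obtain ⟨a, b, hab⟩ := hpq
  have hK0 : 0 ≤ K := by simpa using (norm_nonneg _).trans (hK 0 1)
  obtain ⟨s, h1, h2⟩ := exists_levelPoint_le_lt (Φ := Φ) hq hab x y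
  rw [← sum_levelPoint hq hab hf x 0, ← sum_levelPoint hq hab hf y s, ← Finset.sum_sub_distrib]
  set Y := levelPoint Φ p q a b y
  have hb : ∀ j ∈ Finset.range q, ‖f (levelPoint Φ p q a b x (0 + j)) - f (Y (s + j))‖ ≤
      K * (Y (s + 3 + j) - Y (s - 2 + j)) := by
    intro j _
    refine (hK _ _).trans (mul_le_mul_of_nonneg_left ?_ hK0)
    obtain ⟨h3, h4⟩ := levelPoint_interleave hq hab h h1 h2.le (0 + j)
    rw [zero_add] at h3 h4 ⊢
    have h5 : Y (s - 2 + j) < Y (s + j) :=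
      levelPoint_lt_of_add_two_le hq hab h y (by linarith)
    have h6 : Y (s + j) < Y (s + 3 + j) :=
      levelPoint_lt_of_add_two_le hq hab h y (by linarith)
    rw [abs_le]
    constructor <;> linarith
  refine (norm_sum_le_of_le _ hb).trans (le_of_eq ?_)
  rw [← Finset.mul_sum, Finset.sum_sub_distrib]
  have e := fun c => sum_levelPoint_add_one (Φ := Φ) hq hab y c
  have e1 := e (s - 2)
  have e2 := e (s - 2 + 1)
  have e3 := e (s - 2 + 1 + 1)
  have e4 := e (s - 2 + 1 + 1 + 1)
  have e5 := e (s - 2 + 1 + 1 + 1 + 1)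
  rw [show s - 2 + 1 + 1 + 1 + 1 + 1 = s + 3 by ring] at e5
  change K * (∑ j ∈ Finset.range q, levelPoint Φ p q a b y (s + 3 + j) -
    ∑ j ∈ Finset.range q, levelPoint Φ p q a b y (s - 2 + j)) = K * 5
  rw [e5, e4, e3, e2, e1]
  ring

/-! ### Deviation of the vertices from the mean -/

theorem norm_exp_two_pi_sub_le (s t : ℝ) :
    ‖Complex.exp (2 * Real.pi * Complex.I * (s : ℂ)) -
      Complex.exp (2 * Real.pi * Complex.I * (t : ℂ))‖ ≤ 2 * Real.pi * |s - t| := by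
  have h1 : Complex.exp (2 * Real.pi * Complex.I * (s : ℂ)) -
      Complex.exp (2 * Real.pi * Complex.I * (t : ℂ)) =
      Complex.exp (Complex.I * ((2 * Real.pi * t : ℝ) : ℂ)) *
        (Complex.exp (Complex.I * ((2 * Real.pi * (s - t) : ℝ) : ℂ)) - 1) := by
    rw [mul_sub, ← Complex.exp_add, mul_one]
    congr 2 <;> (push_cast; ring)
  rw [h1, norm_mul, Complex.norm_exp_I_mul_ofReal, one_mul]
  refine (Real.norm_exp_I_mul_ofReal_sub_one_le).trans (le_of_eq ?_)
  rw [Real.norm_eq_abs, abs_mul, abs_of_pos Real.two_pi_pos]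

theorem norm_exp_two_pi (s : ℝ) : ‖Complex.exp (2 * Real.pi * Complex.I * (s : ℂ))‖ = 1 := by
  rw [show 2 * Real.pi * Complex.I * (s : ℂ) = Complex.I * ((2 * Real.pi * s : ℝ) : ℂ) by
    push_cast; ring, Complex.norm_exp_I_mul_ofReal]

theorem periodic_exp_two_pi :
    Function.Periodic (fun s : ℝ => Complex.exp (2 * Real.pi * Complex.I * (s : ℂ))) 1 := by
  intro s
  simp only
  rw [← Complex.exp_periodic (2 * Real.pi * Complex.I * (s : ℂ))]
  congr 1
  push_cast
  ring

theorem toCircle_coe (s : ℝ) : ((AddCircle.toCircle (s : UnitAddCircle) : Circle) : ℂ) =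
    Complex.exp (2 * Real.pi * Complex.I * (s : ℂ)) := by
  rw [AddCircle.toCircle_apply_mk, Circle.coe_exp]
  congr 1
  push_cast
  ring

theorem IsLiftOfHomeo.iterate {Φ : CircleDeg1Lift} {φ : UnitAddCircle ≃ₜ UnitAddCircle}
    (h : IsLiftOfHomeo Φ φ) (k : ℕ) (x : ℝ) :
    (((⇑Φ)^[k] x : ℝ) : UnitAddCircle) = (⇑φ)^[k] (x : UnitAddCircle) := by
  induction k with
  | zero => rfl
  | succ k ih => rw [Function.iterate_succ_apply', Function.iterate_succ_apply', h.2, ih]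

theorem curlicueVertex_add (Φ : CircleDeg1Lift) (x : ℝ) (m n : ℕ) :
    curlicueVertex (orbitSeq Φ x) (m + n) = curlicueVertex (orbitSeq Φ x) m +
      curlicueVertex (orbitSeq Φ ((⇑Φ)^[m] x)) n := by
  simp only [curlicueVertex, orbitSeq, Finset.sum_range_add, ← Function.iterate_add_apply]
  simp only [add_comm m]

/-- The vertices `z_n` average to `n v`, by invariance of the measure. -/
theorem integral_sum_toCircle_iterate {φ : UnitAddCircle ≃ₜ UnitAddCircle}
    {μ : Measure UnitAddCircle} [IsProbabilityMeasure μ] (hμ : MeasurePreserving φ μ μ) (n : ℕ) :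
    Integrable (fun y => ∑ k ∈ Finset.range n, (AddCircle.toCircle ((⇑φ)^[k] y) : ℂ)) μ ∧
      ∫ y, ∑ k ∈ Finset.range n, (AddCircle.toCircle ((⇑φ)^[k] y) : ℂ) ∂μ =
        n * circleAverage μ := by
  have hcont : Continuous fun y : UnitAddCircle => (AddCircle.toCircle y : ℂ) :=
    continuous_subtype_val.comp AddCircle.continuous_toCircle
  have hint : ∀ k ∈ Finset.range n,
      Integrable (fun y => (AddCircle.toCircle ((⇑φ)^[k] y) : ℂ)) μ := fun k _ =>
    (integrable_const (1 : ℝ)).mono'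
      (hcont.comp (φ.continuous.iterate k)).aestronglyMeasurable
      (Eventually.of_forall fun _ => (Circle.norm_coe _).le)
  refine ⟨integrable_finsetSum _ hint, ?_⟩
  rw [integral_finsetSum _ hint]
  have hk : ∀ k ∈ Finset.range n,
      ∫ y, (AddCircle.toCircle ((⇑φ)^[k] y) : ℂ) ∂μ = circleAverage μ := by
    intro k _
    have hm := hμ.iterate k
    have := integral_map (μ := μ) hm.measurable.aemeasurable
      (f := fun y : UnitAddCircle => (AddCircle.toCircle y : ℂ)) hcont.aestronglyMeasurable
    rw [hm.map_eq] at this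
    exact this.symm
  rw [Finset.sum_congr rfl hk]
  simp

/-- Denjoy–Koksma inequality for the vertices of the curlicue. -/
theorem norm_curlicueVertex_convDen_sub_le {φ : UnitAddCircle ≃ₜ UnitAddCircle}
    {Φ : CircleDeg1Lift} (hΦ : IsLiftOfHomeo Φ φ) (hρ : Irrational Φ.translationNumber)
    {μ : Measure UnitAddCircle} [IsProbabilityMeasure μ] (hμ : MeasurePreserving φ μ μ)
    (x : ℝ) (i : ℕ) :
    ‖curlicueVertex (orbitSeq Φ x) (convDen Φ.translationNumber i) -
      (convDen Φ.translationNumber i : ℂ) * circleAverage μ‖ ≤ 2 * Real.pi * 5 := by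
  obtain ⟨p, hpq, happ⟩ := exists_convergent hρ i
  set q := convDen Φ.translationNumber i with hqdef
  have hq : 0 < q := convDen_pos _ i
  have happ' : |Φ.translationNumber - p / q| ≤ 1 / (q : ℝ) ^ 2 := by
    refine happ.trans ?_
    rw [sq]
    have := convDen_le_succ Φ.translationNumber i
    gcongr
  obtain ⟨hint, hmean⟩ := integral_sum_toCircle_iterate hμ q
  rw [← hmean]
  have hconst : curlicueVertex (orbitSeq Φ x) q =
      ∫ _y, curlicueVertex (orbitSeq Φ x) q ∂μ := by simp
  rw [hconst, ← integral_sub (integrable_const _) hint]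
  refine (norm_integral_le_of_norm_le_const (C := 2 * Real.pi * 5)
    (Eventually.of_forall fun y => ?_)).trans (by simp)
  induction y using QuotientAddGroup.induction_on with
  | H y =>
    have h := norm_birkhoff_sub_birkhoff_le hq hpq happ' periodic_exp_two_pi
      norm_exp_two_pi_sub_le x y
    simpa only [← toCircle_coe, hΦ.iterate, curlicueVertex, orbitSeq] using! h

/-- The Ostrowski expansion `n = ∑ b_i q_i` with `b_i ≤ q_{i+1} / q_i` bounds a cocycle that is
bounded at the times `q_i`. -/
theorem norm_cocycle_le {X : Type*} {T : X → X} {D : X → ℕ → ℂ}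
    (hD : ∀ x m n, D x (m + n) = D x m + D (T^[m] x) n) {ρ V : ℝ} (hV : 0 ≤ V)
    (hq : ∀ x i, ‖D x (convDen ρ i)‖ ≤ V) (m : ℕ) (x : X) (n : ℕ) :
    ‖D x n‖ ≤ V * ((n : ℝ) / convDen ρ m +
      ∑ i ∈ Finset.range m, (convDen ρ (i + 1) : ℝ) / convDen ρ i) := by
  have hmul : ∀ i (b : ℕ) x, ‖D x (b * convDen ρ i)‖ ≤ b * V := by
    intro i b
    induction b with
    | zero =>
      intro x
      have := hD x 0 0
      simp only [add_zero, Function.iterate_zero, id_eq, left_eq_add] at this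
      simp [this]
    | succ b ih =>
      intro x
      rw [add_mul, one_mul, hD]
      refine (norm_add_le _ _).trans ((add_le_add (ih x) (hq _ i)).trans (le_of_eq ?_))
      push_cast
      ring
  induction m generalizing x n with
  | zero => simpa [mul_comm] using hmul 0 n x
  | succ m ih =>
    set q := convDen ρ (m + 1) with hqdef
    have hq0 : 0 < q := convDen_pos ρ _
    have hm0 : 0 < convDen ρ m := convDen_pos ρ _
    have hn : n = n / q * q + n % q := by rw [mul_comm]; exact (Nat.div_add_mod n q).symm
    have h1 : ((n / q : ℕ) : ℝ) ≤ n / q := Nat.cast_div_le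
    have h2 : ((n % q : ℕ) : ℝ) ≤ q := by exact_mod_cast (Nat.mod_lt n hq0).le
    have h3 : ((n % q : ℕ) : ℝ) / convDen ρ m ≤ q / convDen ρ m := by gcongr
    rw [Finset.sum_range_succ]
    calc ‖D x n‖ = ‖D x (n / q * q) + D (T^[n / q * q] x) (n % q)‖ := by rw [← hD, ← hn]
      _ ≤ ((n / q : ℕ) : ℝ) * V + V * (((n % q : ℕ) : ℝ) / convDen ρ m +
          ∑ i ∈ Finset.range m, (convDen ρ (i + 1) : ℝ) / convDen ρ i) :=
        (norm_add_le _ _).trans (add_le_add (hmul _ _ _) (ih _ _))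
      _ ≤ n / q * V + V * (q / convDen ρ m +
          ∑ i ∈ Finset.range m, (convDen ρ (i + 1) : ℝ) / convDen ρ i) := by gcongr
      _ = _ := by ring

/-- There are `O(log n)` denominators up to `n`. -/
theorem index_add_one_le_log {ρ : ℝ} (hρ : Irrational ρ) {m n : ℕ} (hn : 2 ≤ n)
    (h : convDen ρ m ≤ n) : (m : ℝ) + 1 ≤ 4 / Real.log 2 * Real.log n := by
  have h2 : 0 < Real.log 2 := Real.log_pos one_lt_two
  have hn' : (2 : ℝ) ≤ n := by exact_mod_cast hn
  have hlog : Real.log 2 ≤ Real.log n := Real.log_le_log two_pos hn'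
  have h1 : (2 : ℝ) ^ m ≤ 2 * (n : ℝ) ^ 2 := by
    exact_mod_cast (two_pow_le_convDen_sq hρ m).trans (by gcongr)
  have h3 := Real.log_le_log (by positivity) h1
  rw [Real.log_pow, Real.log_mul (by norm_num) (by positivity), Real.log_pow] at h3
  push_cast at h3
  rw [div_mul_eq_mul_div, le_div_iff₀ h2]
  linarith

/-- A cocycle bounded at the times `q_i` is `O(R log n)` if the ratios `q_{i+1} / q_i`, truncated
at `n`, are at most `R`. -/
theorem norm_cocycle_le_log {X : Type*} {T : X → X} {D : X → ℕ → ℂ}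
    (hD : ∀ x m n, D x (m + n) = D x m + D (T^[m] x) n) {ρ V : ℝ} (hρ : Irrational ρ) (hV : 0 ≤ V)
    (hq : ∀ x i, ‖D x (convDen ρ i)‖ ≤ V) (x : X) {m n : ℕ} (hn : 2 ≤ n) (hm : convDen ρ m ≤ n)
    {R : ℝ} (hR : (n : ℝ) / convDen ρ m ≤ R)
    (hR' : ∀ i < m, (convDen ρ (i + 1) : ℝ) / convDen ρ i ≤ R) :
    ‖D x n‖ ≤ V * (4 / Real.log 2) * (R * Real.log n) := by
  have hR0 : 0 ≤ R := le_trans (by positivity) hR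
  calc ‖D x n‖ ≤ V * ((n : ℝ) / convDen ρ m +
        ∑ i ∈ Finset.range m, (convDen ρ (i + 1) : ℝ) / convDen ρ i) :=
      norm_cocycle_le hD hV hq m x n
    _ ≤ V * (R + m * R) := by
      gcongr
      refine (Finset.sum_le_card_nsmul _ _ R fun i hi => hR' i (Finset.mem_range.1 hi)).trans ?_
      simp
    _ = V * (((m : ℝ) + 1) * R) := by ring
    _ ≤ V * (4 / Real.log 2 * Real.log n * R) := by
      gcongr
      exact index_add_one_le_log hρ hn hm
    _ = _ := by ring

/-- For `ρ` Diophantine of type `r`, consecutive denominators satisfy `q_{i+1} ≤ q_i ^ r / C`. -/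
theorem IsDiophantineOfType.exists_convDen_succ_le {ρ r : ℝ} (hρ : Irrational ρ)
    (h : IsDiophantineOfType ρ r) :
    ∃ c : ℝ, 0 < c ∧ ∀ i, (convDen ρ (i + 1) : ℝ) ^ (1 / r) ≤ c * convDen ρ i := by
  obtain ⟨hr, C, hC, h⟩ := h
  have hr0 : 0 < r := by linarith
  refine ⟨(1 / C) ^ (1 / r), by positivity, fun i => ?_⟩
  obtain ⟨p, -, happ⟩ := exists_convergent hρ i
  have h0 : (0 : ℝ) < convDen ρ i := by exact_mod_cast convDen_pos ρ i
  have h1 : (0 : ℝ) < convDen ρ (i + 1) := by exact_mod_cast convDen_pos ρ (i + 1)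
  have h2 := (h p _ (convDen_pos ρ i)).trans happ
  rw [div_le_div_iff₀ (by positivity) (by positivity), one_mul, Real.rpow_add h0,
    Real.rpow_one] at h2
  have h3 : (convDen ρ (i + 1) : ℝ) ≤ 1 / C * (convDen ρ i : ℝ) ^ r := by
    rw [div_mul_eq_mul_div, one_mul, le_div_iff₀ hC]
    nlinarith
  calc (convDen ρ (i + 1) : ℝ) ^ (1 / r) ≤ (1 / C * (convDen ρ i : ℝ) ^ r) ^ (1 / r) := by gcongr
    _ = (1 / C) ^ (1 / r) * convDen ρ i := by
      rw [Real.mul_rpow (by positivity) (by positivity), one_div r, Real.rpow_rpow_inv h0.le hr0.ne']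

theorem HasSlowPartialQuotients.exists_ratio_le {ρ ε : ℝ} (hρ : Irrational ρ) (hε : 0 < ε)
    (h : HasSlowPartialQuotients ρ ε) :
    ∃ K : ℝ, 0 < K ∧
      ∀ i : ℕ, (convDen ρ (i + 1) : ℝ) / convDen ρ i ≤ K * ((i : ℝ) + 1) ^ (1 + ε) := by
  have h1 : ∀ i : ℕ, (1 : ℝ) ≤ ((i : ℝ) + 1) ^ (1 + ε) := fun i =>
    Real.one_le_rpow (by linarith [i.cast_nonneg (α := ℝ)]) (by linarith)
  obtain ⟨N, hN⟩ := eventually_atTop.1 h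
  have hsum : 0 ≤ ∑ i ∈ Finset.range N, (convDen ρ (i + 1) : ℝ) / convDen ρ i :=
    Finset.sum_nonneg fun i _ => by positivity
  refine ⟨2 + ∑ i ∈ Finset.range N, (convDen ρ (i + 1) : ℝ) / convDen ρ i, by positivity,
    fun i => ?_⟩
  rcases lt_or_ge i N with hi | hi
  · have h2 := Finset.single_le_sum (f := fun i => (convDen ρ (i + 1) : ℝ) / convDen ρ i)
      (fun i _ => by positivity) (Finset.mem_range.2 hi)
    nlinarith [h1 i]
  · obtain ⟨a, ha, -, hle⟩ := convDen_succ_le hρ i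
    have h0 : (0 : ℝ) < convDen ρ i := by exact_mod_cast convDen_pos ρ i
    rw [div_le_iff₀ h0]
    refine hle.trans (mul_le_mul_of_nonneg_right ?_ h0.le)
    nlinarith [hN i hi a ha, h1 i]

section Cocycle

variable {X : Type*} {T : X → X} {D : X → ℕ → ℂ}
  (hD : ∀ x m n, D x (m + n) = D x m + D (T^[m] x) n) {ρ V : ℝ} (hρ : Irrational ρ) (hV : 0 ≤ V)
  (hq : ∀ x i, ‖D x (convDen ρ i)‖ ≤ V)
include hD hρ hV hq

theorem exists_norm_cocycle_le_of_diophantine {r : ℝ} (h : IsDiophantineOfType ρ r) :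
    ∃ M : ℝ, ∀ (x : X) (n : ℕ), 2 ≤ n → ‖D x n‖ ≤ M * ((n : ℝ) ^ (1 - 1 / r) * Real.log n) := by
  obtain ⟨c, hc, hle⟩ := h.exists_convDen_succ_le hρ
  have hr : 1 < r := h.1
  have hr1 : 0 < 1 / r := by positivity
  have hr2 : 1 / r < 1 := by rw [div_lt_one] <;> linarith
  refine ⟨V * (4 / Real.log 2) * c, fun x n hn => ?_⟩
  obtain ⟨m, hm, hm'⟩ := exists_convDen_le_lt hρ (by omega : 1 ≤ n)
  have hn0 : (0 : ℝ) < n := by exact_mod_cast (by omega : 0 < n)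
  have hpos : ∀ i, (0 : ℝ) < convDen ρ i := fun i => by exact_mod_cast convDen_pos ρ i
  -- If `t ≤ q_{i+1}` and `t ≤ n`, then `t / q_i ≤ c t ^ (1 - 1 / r) ≤ c n ^ (1 - 1 / r)`.
  have key : ∀ (i : ℕ) (t : ℝ), 0 < t → t ≤ convDen ρ (i + 1) → t ≤ n →
      t / convDen ρ i ≤ c * (n : ℝ) ^ (1 - 1 / r) := by
    intro i t ht hti htn
    have h1 : t = t ^ (1 - 1 / r) * t ^ (1 / r) := by
      rw [← Real.rpow_add ht, sub_add_cancel, Real.rpow_one]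
    rw [div_le_iff₀ (hpos i)]
    calc t = t ^ (1 - 1 / r) * t ^ (1 / r) := h1
      _ ≤ (n : ℝ) ^ (1 - 1 / r) * (convDen ρ (i + 1) : ℝ) ^ (1 / r) := by
        gcongr
      _ ≤ (n : ℝ) ^ (1 - 1 / r) * (c * convDen ρ i) := by gcongr; exact hle i
      _ = _ := by ring
  refine (norm_cocycle_le_log hD hρ hV hq x hn hm (R := c * (n : ℝ) ^ (1 - 1 / r))
    (key m n hn0 (by exact_mod_cast hm'.le) le_rfl) fun i hi => ?_).trans (le_of_eq (by ring))
  refine key i _ (hpos _) le_rfl ?_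
  exact_mod_cast (convDen_mono ρ hi).trans hm

theorem exists_norm_cocycle_le_of_boundedType (h : IsOfBoundedType ρ) :
    ∃ M : ℝ, ∀ (x : X) (n : ℕ), 2 ≤ n → ‖D x n‖ ≤ M * Real.log n := by
  obtain ⟨B, hB⟩ := h
  simp only [← convDen_cast] at hB
  refine ⟨V * (4 / Real.log 2) * B, fun x n hn => ?_⟩
  obtain ⟨m, hm, hm'⟩ := exists_convDen_le_lt hρ (by omega : 1 ≤ n)
  have h1 : (n : ℝ) / convDen ρ m ≤ convDen ρ (m + 1) / convDen ρ m := by gcongr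
  exact (norm_cocycle_le_log hD hρ hV hq x hn hm (h1.trans (hB m)) fun i _ => hB i).trans
    (le_of_eq (by ring))

theorem exists_norm_cocycle_le_of_slow {ε : ℝ} (hε : 0 < ε) (h : HasSlowPartialQuotients ρ ε) :
    ∃ M : ℝ, ∀ (x : X) (n : ℕ), 2 ≤ n → ‖D x n‖ ≤ M * (Real.log n) ^ (2 + ε) := by
  obtain ⟨K, hK, hle⟩ := h.exists_ratio_le hρ hε
  have hlog2 : 0 < Real.log 2 := Real.log_pos one_lt_two
  refine ⟨V * (4 / Real.log 2) * (K * (4 / Real.log 2) ^ (1 + ε)), fun x n hn => ?_⟩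
  obtain ⟨m, hm, hm'⟩ := exists_convDen_le_lt hρ (by omega : 1 ≤ n)
  have hlog : 0 < Real.log n := Real.log_pos (by exact_mod_cast (by omega : 1 < n))
  have hle' : ∀ i ≤ m, (convDen ρ (i + 1) : ℝ) / convDen ρ i ≤
      K * (4 / Real.log 2 * Real.log n) ^ (1 + ε) := by
    intro i hi
    refine (hle i).trans ?_
    gcongr
    refine le_trans ?_ (index_add_one_le_log hρ hn hm)
    gcongr
  have h1 : (n : ℝ) / convDen ρ m ≤ convDen ρ (m + 1) / convDen ρ m := by gcongr
  refine (norm_cocycle_le_log hD hρ hV hq x hn hm (h1.trans (hle' m le_rfl))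
    fun i hi => hle' i hi.le).trans (le_of_eq ?_)
  rw [Real.mul_rpow (by positivity) hlog.le, show 2 + ε = (1 + ε) + 1 by ring,
    Real.rpow_add hlog _ 1, Real.rpow_one]
  ring

/-- A cocycle bounded at the times `q_i` is `o(n)`, uniformly in the initial point. -/
theorem exists_norm_cocycle_le_add_mul {δ : ℝ} (hδ : 0 < δ) :
    ∃ K : ℝ, 0 ≤ K ∧ ∀ (x : X) (n : ℕ), ‖D x n‖ ≤ K + δ * n := by
  have hlim : Tendsto (fun m => V / (convDen ρ m : ℝ)) atTop (𝓝 0) :=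
    (tendsto_natCast_atTop_atTop.comp (tendsto_convDen hρ)).const_div_atTop V
  obtain ⟨m, hm⟩ := (hlim.eventually_lt_const hδ).exists
  refine ⟨V * ∑ i ∈ Finset.range m, (convDen ρ (i + 1) : ℝ) / convDen ρ i,
    mul_nonneg hV (Finset.sum_nonneg fun i _ => by positivity), fun x n => ?_⟩
  calc ‖D x n‖ ≤ V * ((n : ℝ) / convDen ρ m +
        ∑ i ∈ Finset.range m, (convDen ρ (i + 1) : ℝ) / convDen ρ i) :=
      norm_cocycle_le hD hV hq m x n
    _ = V * ∑ i ∈ Finset.range m, (convDen ρ (i + 1) : ℝ) / convDen ρ i +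
        V / convDen ρ m * n := by ring
    _ ≤ _ := by gcongr

end Cocycle

/-! ### The area of a neighbourhood of nonparallel segments -/

theorem conj_mul_self_of_norm_one {c : ℂ} (hc : ‖c‖ = 1) : (starRingEnd ℂ) c * c = 1 := by
  rw [mul_comm, Complex.mul_conj, Complex.normSq_eq_norm_sq, hc]
  simp

/-- The rigid motion taking `z` to `0` and the unit direction `c` to `1`. -/
theorem measurePreserving_sub_mul_conj (z : ℂ) {c : ℂ} (hc : ‖c‖ = 1) :
    MeasurePreserving (fun w : ℂ => (w - z) * (starRingEnd ℂ) c) := by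
  have hu : (starRingEnd ℂ) c ∈ Submonoid.unitSphere ℂ := by
    change (starRingEnd ℂ) c ∈ Metric.sphere (0 : ℂ) 1
    simpa using hc
  have h1 := (rotation (⟨(starRingEnd ℂ) c, hu⟩ : Circle)).measurePreserving
  have h2 := h1.comp (measurePreserving_sub_right (volume : Measure ℂ) z)
  have h3 : (fun w : ℂ => (w - z) * (starRingEnd ℂ) c) =
      rotation (⟨(starRingEnd ℂ) c, hu⟩ : Circle) ∘ fun w => w - z := by
    funext w
    exact mul_comm _ _
  rw [h3]
  exact h2

theorem volume_reProdIm (A B : Set ℝ) : volume (A ×ℂ B) = volume A * volume B := by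
  have h := Complex.volume_preserving_equiv_real_prod.measure_preimage_equiv (A ×ˢ B)
  rw [Measure.volume_eq_prod, Measure.prod_prod] at h
  exact h

theorem volume_abs_add_mul_lt_le (a : ℝ) {b : ℝ} (hb : b ≠ 0) (η : ℝ) :
    volume {s : ℝ | |a + s * b| < η} ≤ ENNReal.ofReal (2 * η / |b|) := by
  have hb' : 0 < |b| := abs_pos.2 hb
  have hsub : {s : ℝ | |a + s * b| < η} ⊆ Metric.ball (-a / b) (η / |b|) := by
    intro s hs
    rw [Metric.mem_ball, Real.dist_eq, lt_div_iff₀ hb', ← abs_mul]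
    have : (s - -a / b) * b = a + s * b := by field_simp; ring
    rwa [this]
  refine (measure_mono hsub).trans (le_of_eq ?_)
  rw [Real.volume_ball]
  congr 1
  ring

/-- Finitely many unit segments, no two of them parallel, overlap so little that the area of the
`ε`-neighbourhood of their union is at least `ε` per segment for small `ε`. -/
theorem eventually_card_mul_le_volume_thickening {z e : ℕ → ℂ} (he : ∀ k, ‖e k‖ = 1)
    (hne : ∀ j k, j ≠ k → (e k * (starRingEnd ℂ) (e j)).im ≠ 0) {G : Set ℂ}
    (hG : ∀ k, ∀ s ∈ Set.Ioo (0 : ℝ) 1, z k + s * e k ∈ G) (N : ℕ) :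
    ∀ᶠ ε in 𝓝[>] (0 : ℝ), N * ENNReal.ofReal ε ≤ volume (Metric.thickening ε G) := by
  set β : ℕ → ℕ → ℝ := fun k j => |(e k * (starRingEnd ℂ) (e j)).im|
  have hsmall : ∀ᶠ ε in 𝓝[>] (0 : ℝ), ∀ k ∈ Finset.range N,
      ∑ j ∈ (Finset.range N).erase k, 2 * (2 * ε) / β k j < 1 / 2 := by
    refine (Finset.eventually_all _).2 fun k _ => ?_
    have hc : Continuous fun ε : ℝ => ∑ j ∈ (Finset.range N).erase k, 2 * (2 * ε) / β k j := by
      fun_prop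
    refine (hc.tendsto 0).mono_left nhdsWithin_le_nhds |>.eventually_lt_const ?_
    simp
  filter_upwards [hsmall, self_mem_nhdsWithin] with ε hε hε0
  have hε0 : 0 < ε := hε0
  -- `A k`: the parameters on the segment `k` of points at distance at least `2 ε` from the lines
  -- carrying the other segments.
  set A : ℕ → Set ℝ := fun k => Set.Ioo 0 1 \ ⋃ j ∈ (Finset.range N).erase k,
    {s : ℝ | |((z k - z j) * (starRingEnd ℂ) (e j)).im +
      s * (e k * (starRingEnd ℂ) (e j)).im| < 2 * ε} with hA
  have hAmeas : ∀ k, MeasurableSet (A k) := fun k =>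
    measurableSet_Ioo.diff (Finset.measurableSet_biUnion _ fun j _ =>
      (isOpen_lt (by fun_prop) continuous_const).measurableSet)
  have hAvol : ∀ k ∈ Finset.range N, ENNReal.ofReal (1 / 2) ≤ volume (A k) := by
    intro k hk
    have h1 : volume (⋃ j ∈ (Finset.range N).erase k,
        {s : ℝ | |((z k - z j) * (starRingEnd ℂ) (e j)).im +
          s * (e k * (starRingEnd ℂ) (e j)).im| < 2 * ε}) ≤ ENNReal.ofReal (1 / 2) := by
      refine (measure_biUnion_finset_le _ _).trans ?_
      refine (Finset.sum_le_sum fun j hj => volume_abs_add_mul_lt_le _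
        (hne j k (Finset.ne_of_mem_erase hj)) _).trans ?_
      rw [← ENNReal.ofReal_sum_of_nonneg fun j _ => by positivity]
      exact ENNReal.ofReal_le_ofReal (hε k hk).le
    calc ENNReal.ofReal (1 / 2) = ENNReal.ofReal (1 - 0) - ENNReal.ofReal (1 / 2) := by
          rw [← ENNReal.ofReal_sub _ (by norm_num)]; norm_num
      _ = volume (Set.Ioo (0 : ℝ) 1) - ENNReal.ofReal (1 / 2) := by rw [Real.volume_Ioo]
      _ ≤ _ := (tsub_le_tsub_left h1 _).trans le_measure_sdiff
  -- `B k`: the points at distance less than `ε` from the segment `k` that project into `A k`.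
  set B : ℕ → Set ℂ := fun k =>
    (fun w : ℂ => (w - z k) * (starRingEnd ℂ) (e k)) ⁻¹' (A k ×ℂ Set.Ioo (-ε) ε) with hB
  have hmeas : ∀ k, MeasurableSet (A k ×ℂ Set.Ioo (-ε) ε) := fun k =>
    (Complex.measurable_re (hAmeas k)).inter (Complex.measurable_im measurableSet_Ioo)
  have hBmeas : ∀ k, MeasurableSet (B k) := fun k =>
    (measurePreserving_sub_mul_conj (z k) (he k)).measurable (hmeas k)
  have hBvol : ∀ k ∈ Finset.range N, ENNReal.ofReal ε ≤ volume (B k) := by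
    intro k hk
    rw [hB, (measurePreserving_sub_mul_conj (z k) (he k)).measure_preimage
      (hmeas k).nullMeasurableSet, volume_reProdIm, Real.volume_Ioo]
    calc ENNReal.ofReal ε = ENNReal.ofReal (1 / 2) * ENNReal.ofReal (ε - -ε) := by
          rw [← ENNReal.ofReal_mul (by norm_num)]; congr 1; ring
      _ ≤ _ := by gcongr; exact hAvol k hk
  have hpt : ∀ k (w : ℂ), w = z k + (((w - z k) * (starRingEnd ℂ) (e k)).re : ℂ) * e k +
      (((w - z k) * (starRingEnd ℂ) (e k)).im : ℂ) * Complex.I * e k := by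
    intro k w
    have h1 := Complex.re_add_im ((w - z k) * (starRingEnd ℂ) (e k))
    linear_combination (-(w - z k)) * conj_mul_self_of_norm_one (he k) - e k * h1
  have hdisj : (↑(Finset.range N) : Set ℕ).PairwiseDisjoint B := by
    intro k hk j hj hkj
    refine Set.disjoint_left.2 fun w hwk hwj => ?_
    obtain ⟨h1, h2⟩ := hwk
    obtain ⟨-, h3⟩ := hwj
    set t := (w - z k) * (starRingEnd ℂ) (e k) with ht
    have h4 : 2 * ε ≤ |((z k - z j) * (starRingEnd ℂ) (e j)).im +
        t.re * (e k * (starRingEnd ℂ) (e j)).im| := by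
      by_contra! hlt
      exact h1.2 (Set.mem_biUnion (Finset.mem_erase.2 ⟨hkj.symm, hj⟩) hlt)
    have h5 : (w - z j) * (starRingEnd ℂ) (e j) = (z k - z j) * (starRingEnd ℂ) (e j) +
        (t.re : ℂ) * (e k * (starRingEnd ℂ) (e j)) +
        (t.im : ℂ) * (Complex.I * (e k * (starRingEnd ℂ) (e j))) := by
      conv_lhs => rw [hpt k w]
      ring
    have h6 := congrArg Complex.im h5
    rw [Complex.add_im, Complex.add_im, Complex.im_ofReal_mul, Complex.im_ofReal_mul] at h6
    have h7 : |t.im * (Complex.I * (e k * (starRingEnd ℂ) (e j))).im| ≤ |t.im| := by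
      rw [abs_mul]
      refine mul_le_of_le_one_right (abs_nonneg _) ((Complex.abs_im_le_norm _).trans ?_)
      simp [he]
    have h8 : |t.im| < ε := abs_lt.2 h2
    have h9 : |((w - z j) * (starRingEnd ℂ) (e j)).im| < ε := abs_lt.2 h3
    have h10 := abs_sub_abs_le_abs_sub (((z k - z j) * (starRingEnd ℂ) (e j)).im +
        t.re * (e k * (starRingEnd ℂ) (e j)).im) ((w - z j) * (starRingEnd ℂ) (e j)).im
    rw [h6, sub_add_cancel_left, abs_neg] at h10
    rw [h6] at h9
    linarith
  have hsub : (⋃ k ∈ Finset.range N, B k) ⊆ Metric.thickening ε G := by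
    refine Set.iUnion₂_subset fun k _ w hw => ?_
    obtain ⟨h1, h2⟩ := hw
    refine Metric.mem_thickening_iff.2 ⟨_, hG k _ h1.1, ?_⟩
    rw [dist_eq_norm, sub_eq_of_eq_add' (hpt k w), norm_mul, norm_mul, he, Complex.norm_I, Complex.norm_real, mul_one,
      mul_one]
    exact abs_lt.2 h2
  calc (N : ENNReal) * ENNReal.ofReal ε = ∑ k ∈ Finset.range N, ENNReal.ofReal ε := by simp
    _ ≤ ∑ k ∈ Finset.range N, volume (B k) := Finset.sum_le_sum hBvol
    _ = volume (⋃ k ∈ Finset.range N, B k) :=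
      (measure_biUnion_finset hdisj fun k _ => hBmeas k).symm
    _ ≤ _ := measure_mono hsub

theorem sq_eq_sq_of_im_mul_conj_eq_zero {a b : ℂ} (ha : ‖a‖ = 1) (hb : ‖b‖ = 1)
    (h : (a * (starRingEnd ℂ) b).im = 0) : a ^ 2 = b ^ 2 := by
  set w := a * (starRingEnd ℂ) b with hw
  have h1 : w = (w.re : ℂ) := by
    apply Complex.ext <;> simp [h]
  have h2 : |w.re| = 1 := by
    have h3 : ‖w‖ = 1 := by simp [hw, ha, hb]
    rwa [h1, Complex.norm_real] at h3
  have h4 : w ^ 2 = 1 := by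
    rw [h1, ← Complex.ofReal_pow, ← sq_abs, h2]
    simp
  have h5 := conj_mul_self_of_norm_one hb
  have h6 : w * b = a := by rw [hw, mul_assoc, h5, mul_one]
  rw [← h6, mul_pow, h4, one_mul]

theorem exists_pairwise_im_mul_conj_ne_zero {e : ℕ → ℂ} (he : ∀ k, ‖e k‖ = 1)
    (hinj : Function.Injective e) :
    ∃ σ : ℕ → ℕ, ∀ j k, j ≠ k → (e (σ k) * (starRingEnd ℂ) (e (σ j))).im ≠ 0 := by
  have hinf : (Set.range fun k => e k ^ 2).Infinite := by
    intro hfin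
    refine Set.infinite_range_of_injective hinj ((hfin.preimage' fun b _ => ?_).subset
      (s := (fun w : ℂ => w ^ 2) ⁻¹' Set.range fun k => e k ^ 2) ?_)
    · rcases Set.eq_empty_or_nonempty ((fun w : ℂ => w ^ 2) ⁻¹' {b}) with h | ⟨c, hc⟩
      · rw [h]; exact Set.finite_empty
      · refine (Set.toFinite {c, -c}).subset fun w hw => ?_
        exact sq_eq_sq_iff_eq_or_eq_neg.1 ((hw : w ^ 2 = b).trans (hc : c ^ 2 = b).symm)
    · rintro _ ⟨k, rfl⟩
      exact ⟨k, rfl⟩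
  choose σ hσ using fun i : ℕ => (hinf.natEmbedding _ i).2
  refine ⟨σ, fun j k hjk h => hjk ?_⟩
  have h1 := sq_eq_sq_of_im_mul_conj_eq_zero (he _) (he _) h
  have h2 : e (σ k) ^ 2 = _ := hσ k
  have h3 : e (σ j) ^ 2 = _ := hσ j
  rw [h2, h3] at h1
  exact (hinf.natEmbedding _).injective (Subtype.ext h1.symm)

/-! ### Superficiality of curlicues -/

theorem curlicue_natCast (u : ℕ → ℝ) (n : ℕ) : curlicue u n = curlicueVertex u n := by
  simp [curlicue]

theorem curlicue_natCast_add (u : ℕ → ℝ) (n : ℕ) {s : ℝ} (hs : s ∈ Set.Ioo (0 : ℝ) 1) :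
    curlicue u (n + s) = curlicueVertex u n +
      s * Complex.exp (2 * Real.pi * Complex.I * (u n : ℂ)) := by
  have h : ⌊(n : ℝ) + s⌋₊ = n := by
    rw [add_comm, Nat.floor_add_natCast hs.1.le, Nat.floor_eq_zero.2 hs.2, zero_add]
  rw [curlicue, h, add_sub_cancel_left]

theorem norm_curlicue_le (u : ℕ → ℝ) {t : ℝ} (ht : 0 ≤ t) :
    ‖curlicue u t‖ ≤ ‖curlicueVertex u ⌊t⌋₊‖ + 1 := by
  refine (norm_add_le _ _).trans (add_le_add le_rfl ?_)
  rw [norm_mul, norm_exp_two_pi, mul_one, Complex.norm_real, Real.norm_eq_abs, abs_le]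
  constructor <;> linarith [Nat.floor_le ht, Nat.lt_floor_add_one t]

theorem norm_curlicueVertex_le (u : ℕ → ℝ) (n : ℕ) : ‖curlicueVertex u n‖ ≤ n := by
  refine (norm_sum_le_of_le _ fun k _ => (norm_exp_two_pi (u k)).le).trans ?_
  simp

theorem isBounded_curlicue_Icc (u : ℕ → ℝ) (t : ℝ) :
    Bornology.IsBounded (curlicue u '' Set.Icc 0 t) := by
  refine isBounded_iff_forall_norm_le.2 ⟨t + 1, ?_⟩
  rintro _ ⟨s, hs, rfl⟩
  have := norm_curlicue_le u hs.1
  have := norm_curlicueVertex_le u ⌊s⌋₊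
  have := Nat.floor_le hs.1
  linarith [hs.2]

/-- The diameter of `Γ_t` is sublinear in `t` if the vertices grow sublinearly. -/
theorem tendsto_div_diam_curlicue {u : ℕ → ℝ}
    (h : ∀ δ : ℝ, 0 < δ → ∃ K : ℝ, 0 ≤ K ∧ ∀ n : ℕ, ‖curlicueVertex u n‖ ≤ K + δ * n) :
    Tendsto (fun t : ℝ => t / Metric.diam (curlicue u '' Set.Icc 0 t)) atTop atTop := by
  refine tendsto_atTop.2 fun b => ?_
  set c := max b 1 with hc
  have hc0 : 0 < c := by positivity
  obtain ⟨K, hK, hle⟩ := h (1 / (4 * c)) (by positivity)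
  filter_upwards [eventually_ge_atTop (4 * c * (K + 1)), eventually_ge_atTop 1] with t ht ht1
  have hdiam : Metric.diam (curlicue u '' Set.Icc 0 t) ≤ 2 * (K + 1 + 1 / (4 * c) * t) := by
    have hnorm : ∀ s ∈ Set.Icc 0 t, ‖curlicue u s‖ ≤ K + 1 + 1 / (4 * c) * t := by
      intro s hs
      have h1 := norm_curlicue_le u hs.1
      have h2 := hle ⌊s⌋₊
      have h3 : 1 / (4 * c) * (⌊s⌋₊ : ℝ) ≤ 1 / (4 * c) * t := by
        gcongr
        exact (Nat.floor_le hs.1).trans hs.2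
      linarith
    refine Metric.diam_le_of_forall_dist_le (by positivity) ?_
    rintro _ ⟨s, hs, rfl⟩ _ ⟨s', hs', rfl⟩
    rw [dist_eq_norm]
    linarith [norm_sub_le (curlicue u s) (curlicue u s'), hnorm s hs, hnorm s' hs']
  -- The first edge is contained in `Γ_t`, so the diameter is not zero.
  have hpos : 0 < Metric.diam (curlicue u '' Set.Icc 0 t) := by
    have := Metric.dist_le_diam_of_mem (isBounded_curlicue_Icc u t)
      (Set.mem_image_of_mem _ (Set.mem_Icc.2 ⟨zero_le_one, ht1⟩))
      (Set.mem_image_of_mem _ (Set.mem_Icc.2 ⟨le_rfl, by linarith⟩))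
    have h0 := curlicue_natCast u 0
    have h1 := curlicue_natCast u 1
    rw [Nat.cast_zero] at h0
    rw [Nat.cast_one] at h1
    rw [h0, h1, dist_eq_norm] at this
    simp only [curlicueVertex, Finset.range_one, Finset.sum_singleton, Finset.range_zero,
      Finset.sum_empty, sub_zero, norm_exp_two_pi] at this
    linarith
  refine (le_max_left b 1).trans ((le_div_iff₀ hpos).2 ?_)
  calc c * Metric.diam (curlicue u '' Set.Icc 0 t) ≤ c * (2 * (K + 1 + 1 / (4 * c) * t)) := by
        gcongr
    _ = 2 * c * (K + 1) + t / 2 := by field_simp; ring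
    _ ≤ t := by linarith

theorem isSuperficial_curlicue {u : ℕ → ℝ}
    (hinj : Function.Injective fun k => Complex.exp (2 * Real.pi * Complex.I * (u k : ℂ)))
    (h : ∀ δ : ℝ, 0 < δ → ∃ K : ℝ, 0 ≤ K ∧ ∀ n : ℕ, ‖curlicueVertex u n‖ ≤ K + δ * n) :
    IsSuperficial (curlicue u) := by
  by_cases hb : Bornology.IsBounded (curlicue u '' Set.Ici 0)
  · refine Or.inr ⟨hb, tendsto_atTop.2 fun b => ?_⟩
    obtain ⟨σ, hσ⟩ := exists_pairwise_im_mul_conj_ne_zero (fun k => norm_exp_two_pi (u k)) hinj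
    have hG : ∀ k, ∀ s ∈ Set.Ioo (0 : ℝ) 1, curlicueVertex u (σ k) +
        s * Complex.exp (2 * Real.pi * Complex.I * (u (σ k) : ℂ)) ∈ curlicue u '' Set.Ici 0 := by
      intro k s hs
      rw [← curlicue_natCast_add u (σ k) hs]
      exact Set.mem_image_of_mem _ (add_nonneg (Nat.cast_nonneg _) hs.1.le)
    filter_upwards [eventually_card_mul_le_volume_thickening (fun k => norm_exp_two_pi (u (σ k)))
      hσ hG ⌈b⌉₊, self_mem_nhdsWithin] with ε hε hε0
    have hε0 : 0 < ε := hε0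
    rw [le_div_iff₀ hε0]
    have h1 := ENNReal.toReal_mono hb.thickening.measure_lt_top.ne hε
    rw [ENNReal.toReal_mul, ENNReal.toReal_natCast, ENNReal.toReal_ofReal hε0.le] at h1
    refine le_trans ?_ h1
    gcongr
    exact Nat.le_ceil b
  · exact Or.inl ⟨hb, tendsto_div_diam_curlicue h⟩

theorem not_isSuperficial_curlicue {u : ℕ → ℝ} {c : ℝ} (hc : 0 < c)
    (h : ∀ᶠ n : ℕ in atTop, c * n ≤ ‖curlicueVertex u n‖) : ¬ IsSuperficial (curlicue u) := by
  rintro (⟨-, hlim⟩ | ⟨hb, -⟩)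
  · have h1 := (hlim.comp tendsto_natCast_atTop_atTop).eventually_gt_atTop (1 / c)
    obtain ⟨n, h1, h2, hn⟩ := (h1.and (h.and (eventually_ge_atTop 1))).exists
    have hn0 : (0 : ℝ) < n := by exact_mod_cast hn
    have h3 := Metric.dist_le_diam_of_mem (isBounded_curlicue_Icc u n)
      (Set.mem_image_of_mem _ (Set.mem_Icc.2 ⟨hn0.le, le_rfl⟩))
      (Set.mem_image_of_mem _ (Set.mem_Icc.2 ⟨le_rfl, hn0.le⟩))
    have h0 := curlicue_natCast u 0
    rw [Nat.cast_zero] at h0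
    rw [curlicue_natCast, h0, dist_eq_norm] at h3
    simp only [curlicueVertex, Finset.range_zero, Finset.sum_empty, sub_zero] at h3
    have h4 : c * n ≤ Metric.diam (curlicue u '' Set.Icc 0 (n : ℝ)) := h2.trans h3
    simp only [Function.comp_apply] at h1
    rw [div_lt_div_iff₀ hc (lt_of_lt_of_le (by positivity) h4)] at h1
    linarith
  · obtain ⟨R, hR⟩ := isBounded_iff_forall_norm_le.1 hb
    have h1 : Tendsto (fun n : ℕ => c * (n : ℝ)) atTop atTop :=
      tendsto_natCast_atTop_atTop.const_mul_atTop hc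
    obtain ⟨n, h1, h2⟩ := ((h1.eventually_gt_atTop R).and h).exists
    have h3 := hR _ (Set.mem_image_of_mem _ (Set.mem_Ici.2 (Nat.cast_nonneg n)))
    rw [curlicue_natCast] at h3
    linarith

/-! ### Curlicues of circle homeomorphisms -/

/-- The points of an orbit are distinct modulo `1`, the translation number being irrational. -/
theorem injective_exp_orbitSeq {Φ : CircleDeg1Lift} (hρ : Irrational Φ.translationNumber)
    (x : ℝ) :
    Function.Injective fun k =>
      Complex.exp (2 * Real.pi * Complex.I * (orbitSeq Φ x k : ℂ)) := by
  intro j k hjk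
  by_contra hne
  obtain ⟨n, hn⟩ := Complex.exp_eq_exp_iff_exists_int.1 hjk
  have h1 : orbitSeq Φ x j = orbitSeq Φ x k + n := by
    have h2 : (2 * Real.pi * Complex.I : ℂ) * (orbitSeq Φ x j) =
        2 * Real.pi * Complex.I * ((orbitSeq Φ x k : ℂ) + n) := by rw [hn]; ring
    exact_mod_cast mul_left_cancel₀ Complex.two_pi_I_ne_zero h2
  have hd : (j : ℝ) - k ≠ 0 := sub_ne_zero.2 (by exact_mod_cast hne)
  rcases lt_trichotomy ((j : ℝ) * Φ.translationNumber + (0 : ℤ))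
    (k * Φ.translationNumber + n) with h | h | h
  · have := iterate_add_lt_of_lt Φ x h
    simp only [orbitSeq, Int.cast_zero, add_zero] at h1 this
    linarith
  · refine hρ ⟨n / (j - k), ?_⟩
    push_cast at h ⊢
    rw [div_eq_iff hd]
    linarith
  · have := iterate_add_lt_of_lt Φ x h
    simp only [orbitSeq, Int.cast_zero, add_zero] at h1 this
    linarith

theorem theorem4p3
    (φ : UnitAddCircle ≃ₜ UnitAddCircle) (Φ : CircleDeg1Lift) (hΦ : IsLiftOfHomeo Φ φ)
    (hρ : Irrational Φ.translationNumber)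
    (μ : Measure UnitAddCircle) [IsProbabilityMeasure μ] (hμ : MeasurePreserving φ μ μ) :
    (circleAverage μ = 0 →
      (∀ r : ℝ, IsDiophantineOfType Φ.translationNumber r →
        ∃ M : ℝ, ∀ (x₀ : ℝ) (n : ℕ), 2 ≤ n →
          ‖curlicueVertex (orbitSeq Φ x₀) n‖ ≤ M * ((n : ℝ) ^ (1 - 1 / r) * Real.log n)) ∧
      (IsOfBoundedType Φ.translationNumber →
        ∃ M : ℝ, ∀ (x₀ : ℝ) (n : ℕ), 2 ≤ n →
          ‖curlicueVertex (orbitSeq Φ x₀) n‖ ≤ M * Real.log n) ∧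
      (∀ ε : ℝ, 0 < ε → HasSlowPartialQuotients Φ.translationNumber ε →
        ∃ M : ℝ, ∀ (x₀ : ℝ) (n : ℕ), 2 ≤ n →
          ‖curlicueVertex (orbitSeq Φ x₀) n‖ ≤ M * (Real.log n) ^ (2 + ε)) ∧
      (SatisfiesArithmeticCondition Φ.translationNumber →
        ∀ x₀ : ℝ, IsSuperficial (curlicue (orbitSeq Φ x₀)))) ∧
    (circleAverage μ ≠ 0 →
      (∀ x₀ : ℝ, ¬ IsSuperficial (curlicue (orbitSeq Φ x₀))) ∧
      (SatisfiesArithmeticCondition Φ.translationNumber →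
        ∃ (M : ℝ) (l : ℕ → ℝ), Tendsto (fun n : ℕ => l n / (n : ℝ)) atTop (𝓝 0) ∧
          ∀ (x₀ : ℝ) (n : ℕ),
            ‖curlicueVertex (orbitSeq Φ x₀) n - (n : ℂ) * circleAverage μ‖ ≤ M * l n)) := by
  set ρ := Φ.translationNumber
  set v := circleAverage μ
  set D : ℝ → ℕ → ℂ := fun x n => curlicueVertex (orbitSeq Φ x) n - (n : ℂ) * v with hDdef
  have hD : ∀ x m n, D x (m + n) = D x m + D ((⇑Φ)^[m] x) n := by
    intro x m n
    simp only [hDdef, curlicueVertex_add]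
    push_cast
    ring
  have hV : (0 : ℝ) ≤ 2 * Real.pi * 5 := by positivity
  have hq : ∀ x i, ‖D x (convDen ρ i)‖ ≤ 2 * Real.pi * 5 :=
    norm_curlicueVertex_convDen_sub_le hΦ hρ hμ
  have hsmall : ∀ δ : ℝ, 0 < δ → ∃ K : ℝ, 0 ≤ K ∧ ∀ (x : ℝ) (n : ℕ), ‖D x n‖ ≤ K + δ * n :=
    fun δ hδ => exists_norm_cocycle_le_add_mul hD hρ hV hq hδ
  refine ⟨fun hv => ?_, fun hv => ⟨fun x₀ => ?_, fun _ => ?_⟩⟩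
  · have hDv : ∀ x n, D x n = curlicueVertex (orbitSeq Φ x) n := fun x n => by simp [hDdef, hv]
    simp only [hDv] at hsmall
    refine ⟨fun r hr => ?_, fun hb => ?_, fun ε hε hs => ?_, fun _ x₀ => ?_⟩
    · simpa only [hDv] using exists_norm_cocycle_le_of_diophantine hD hρ hV hq hr
    · simpa only [hDv] using exists_norm_cocycle_le_of_boundedType hD hρ hV hq hb
    · simpa only [hDv] using exists_norm_cocycle_le_of_slow hD hρ hV hq hε hs
    · refine isSuperficial_curlicue (injective_exp_orbitSeq hρ x₀) fun δ hδ => ?_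
      obtain ⟨K, hK, hle⟩ := hsmall δ hδ
      exact ⟨K, hK, hle x₀⟩
  · have hv0 : 0 < ‖v‖ := norm_pos_iff.2 hv
    obtain ⟨K, hK, hle⟩ := hsmall (‖v‖ / 4) (by positivity)
    refine not_isSuperficial_curlicue (c := ‖v‖ / 2) (by positivity) ?_
    have hlim : Tendsto (fun n : ℕ => ‖v‖ / 4 * (n : ℝ)) atTop atTop :=
      tendsto_natCast_atTop_atTop.const_mul_atTop (by positivity)
    filter_upwards [hlim.eventually_ge_atTop K] with n hn
    have h1 := hle x₀ n
    have h2 : ‖(n : ℂ) * v‖ = n * ‖v‖ := by rw [norm_mul, Complex.norm_natCast]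
    have h3 := norm_sub_norm_le ((n : ℂ) * v) (curlicueVertex (orbitSeq Φ x₀) n)
    rw [norm_sub_rev, h2] at h3
    simp only [hDdef] at h1
    linarith
  · -- The deviation of the vertices is `o(n)` uniformly in the initial point.
    obtain ⟨K₁, hK₁, hle₁⟩ := hsmall 1 one_pos
    have hbdd : ∀ n, BddAbove (Set.range fun x => ‖D x n‖) := fun n =>
      ⟨K₁ + 1 * n, by rintro _ ⟨x, rfl⟩; exact hle₁ x n⟩
    refine ⟨1, fun n => ⨆ x, ‖D x n‖, ?_, fun x₀ n => ?_⟩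
    · refine Metric.tendsto_nhds.2 fun δ hδ => ?_
      obtain ⟨K, hK, hle⟩ := hsmall (δ / 2) (by positivity)
      have hlim : Tendsto (fun n : ℕ => δ / 2 * (n : ℝ)) atTop atTop :=
        tendsto_natCast_atTop_atTop.const_mul_atTop (by positivity)
      filter_upwards [hlim.eventually_gt_atTop K, eventually_ge_atTop 1] with n hn hn1
      have hn0 : (0 : ℝ) < n := by exact_mod_cast hn1
      have h1 : ⨆ x, ‖D x n‖ ≤ K + δ / 2 * n := ciSup_le fun x => hle x n
      have h2 : 0 ≤ ⨆ x, ‖D x n‖ := Real.iSup_nonneg fun x => norm_nonneg _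
      rw [Real.dist_eq, sub_zero, abs_of_nonneg (by positivity), div_lt_iff₀ hn0]
      linarith
    · rw [one_mul]
      exact le_ciSup (hbdd n) x₀
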